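/- Let $F$ be a global field (a number field or a function field in one variable over a finite field), let $E/F$ be a (possibly infinite) Galois extension, and let $K\subseteq E$ be a finite Galois extension of $F$. A place of a field is an equivalence class of nontrivial real-valued absolute values on it. For a subfield $L\subseteq E$ that is finite Galois over $F$ and a place $w$ of $L$, let $Y(E/L,w)$ denote the set of places of $E$ whose restriction to $L$ is $w$. The set of all places of $E$ carries the topology generated by all such sets $Y(E/L,w)$, each $Y(E/L,w)$ carries the subspace topology, and $\mathrm{Gal}(E/K)$ carries the Krull topology. The group $\mathrm{Gal}(E/K)$ acts on the places of $E$ by $|\sigma(\alpha)|_{\sigma(y)}=|\alpha|_y$ for $\alpha\in E$. Then for every place $v$ of $K$ there exists a $v$-adic transition diagram on $E$, that is, a map $\lambda: Y(E/K,v)\times Y(E/K,v)\to \mathrm{Gal}(E/K)$ such that 1. $\lambda(x,x)$ is the identity element for all $x\in Y(E/K,v)$; 2. $\lambda(x,y)(x)=y$ for all $x,y\in Y(E/K,v)$; 3. $\lambda(y,z)\,\lambda(x,y)=\lambda(x,z)$ for all $x,y,z\in Y(E/K,v)$; 4. $\lambda$ is continuous with respect to the product topology on $Y(E/K,v)\times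 Y(E/K,v)$. -/

import Mathlib

universe u v

/-- A global field: a number field, or a function field in one variable over a finite field
(equivalently, a finite extension of the rational function field over some prime field of
positive characteristic). -/
def IsGlobalField (F : Type u) [Field F] : Prop :=
  NumberField F ∨
    ∃ (p : ℕ) (_ : Fact p.Prime) (_ : Algebra (RatFunc (ZMod p)) F), FunctionField (ZMod p) F

/-- The nontrivial real-valued absolute values on a field. -/
abbrev NontrivialAbs (E : Type u) [Field E] : Type u :=
  {a : AbsoluteValue E ℝ // a.IsNontrivial}

/-- Equivalence of nontrivial absolute values. -/
instance nontrivialAbsSetoid (E : Type u) [Field E] : Setoid (NontrivialAbs E) where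
  r a b := a.1.IsEquiv b.1
  iseqv :=
    { refl := fun a => AbsoluteValue.IsEquiv.refl a.1
      symm := fun h => h.symm
      trans := fun h h' => h.trans h' }

/-- A place of a field is an equivalence class of nontrivial absolute values. -/
def Place (E : Type u) [Field E] : Type u := Quotient (nontrivialAbsSetoid E)

namespace Place

/-- The place represented by a nontrivial absolute value. -/
def mk {E : Type u} [Field E] (a : NontrivialAbs E) : Place E :=
  Quotient.mk (nontrivialAbsSetoid E) a

/-- The place `y` of `E` divides the place `v` of `K`: the restriction of `y` to `K` is `v`, that
is, some absolute value in `y` restricts on `K` to an absolute value in `v`. -/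
def Divides {K : Type u} {E : Type v} [Field K] [Field E] [Algebra K E]
    (y : Place E) (v : Place K) : Prop :=
  ∃ (a : NontrivialAbs E) (b : NontrivialAbs K), mk a = y ∧ mk b = v ∧ a.1.LiesOver b.1

/-- Transport of an absolute value by an automorphism: `|α|_{σ(a)} = |σ⁻¹(α)|_a`. -/
def mapAbs {K : Type u} {E : Type v} [Field K] [Field E] [Algebra K E]
    (σ : Gal(E/K)) (a : NontrivialAbs E) : NontrivialAbs E :=
  ⟨a.1.comp (f := (σ.symm : E →+* E)) σ.symm.injective, by
    obtain ⟨x, hx, hax⟩ := a.2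
    refine ⟨σ x, by simpa using hx, ?_⟩
    change a.1 (σ.symm (σ x)) ≠ 1
    rwa [AlgEquiv.symm_apply_apply]⟩

/-- The action of `Gal(E/K)` on the places of `E`, characterized by `|σ(α)|_{σ(y)} = |α|_y`. -/
instance galAction {K : Type u} {E : Type v} [Field K] [Field E] [Algebra K E] :
    MulAction Gal(E/K) (Place E) where
  smul σ := Quotient.map (mapAbs σ) fun _ _ h x y => h (σ.symm x) (σ.symm y)
  one_smul y := by
    induction y using Quotient.inductionOn with
    | h a => rfl
  mul_smul σ τ y := by
    induction y using Quotient.inductionOn with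
    | h a => rfl

end Place

/-- `Y(E/K, v)`: the set of all places of `E` which divide the place `v` of `K`. -/
def placesOver {F : Type u} {E : Type v} [Field F] [Field E] [Algebra F E]
    (K : IntermediateField F E) (v : Place K) : Set (Place E) :=
  {y | y.Divides v}

/-- The topology on the set of places of `E` generated by the sets `Y(E/K, v)`, where `K` ranges
over the subfields of `E` which are finite Galois over `F` and `v` over the places of `K`. -/
@[reducible]
def placeTopology (F : Type u) (E : Type v) [Field F] [Field E] [Algebra F E] :
    TopologicalSpace (Place E) :=
  TopologicalSpace.generateFrom
    {S | ∃ K : IntermediateField F E, FiniteDimensional F K ∧ IsGalois F K ∧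
      ∃ v : Place K, S = placesOver K v}

/-- `Y(E/K, v)` carries the subspace topology. -/
instance placesOverTopology {F : Type u} {E : Type v} [Field F] [Field E] [Algebra F E]
    (K : IntermediateField F E) (v : Place K) : TopologicalSpace (placesOver K v) :=
  TopologicalSpace.induced Subtype.val (placeTopology F E)

/-- The `v`-adic transition diagrams on `E`; `Gal(E/K)` carries the Krull topology and
`Y(E/K, v) × Y(E/K, v)` the product topology. -/
structure IsTransitionDiagram {F : Type u} {E : Type v} [Field F] [Field E] [Algebra F E]
    (K : IntermediateField F E) (v : Place K)
    (lam : placesOver K v × placesOver K v → Gal(E/K)) : Prop where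
  map_self : ∀ x, lam (x, x) = 1
  smul_eq : ∀ x y, lam (x, y) • (x : Place E) = (y : Place E)
  mul_eq : ∀ x y z, lam (y, z) * lam (x, y) = lam (x, z)
  continuous : Continuous lam

/-- `T(E/K, v)`: the set of all `v`-adic transition diagrams on `E`. -/
def transitionDiagrams {F : Type u} {E : Type v} [Field F] [Field E] [Algebra F E]
    (K : IntermediateField F E) (v : Place K) :
    Set (placesOver K v × placesOver K v → Gal(E/K)) :=
  {lam | IsTransitionDiagram K v lam}

/-!
Fix a place `y₀` of `E` over `v`. If `s : Y(E/K, v) → Gal(E/K)` is continuous with `s y • y₀ = y`,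
then `λ(x, y) = s y * (s x)⁻¹` is a transition diagram, continuous because `Gal(E/K)` is a
topological group. So the theorem asks for a continuous section of the orbit map of `y₀`. The proof
produces `r y = (s y)⁻¹`, which acts on absolute values by composition.

A global field is countable (`IsGlobalField.countable`), hence so is `E`, and `E` is the union of a
sequence `K = L 0 ≤ L 1 ≤ ⋯` of finite Galois extensions of `F` (`exists_galois_tower`). The section
is built along this tower in `exists_continuous_transporter`: an automorphism that is correct on
`L n` is corrected by an automorphism fixing `L n` so as to become correct on `L (n + 1)`. The
correction exists since places of a finite Galois extension with the same restriction to the base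
are conjugate. This is `exists_isEquiv_comp`, a consequence of weak approximation that treats
archimedean and nonarchimedean places alike. All choices at level `n` depend only on the restriction
of the place to `L n`, which is a locally constant function of the place
(`eventually_orderAgreeOn`), so the limit, which exists as `Gal(E/K)` is compact, is continuous.
-/

/-! ### Countability of global fields -/

theorem countable_of_isAlgebraic {F E : Type*} [Field F] [Field E] [Algebra F E] [Countable F]
    [Algebra.IsAlgebraic F E] : Countable E := by
  have := Algebraic.countable F E
  have h : {x : E | IsAlgebraic F x} = Set.univ :=
    Set.eq_univ_of_forall fun x ↦ Algebra.IsAlgebraic.isAlgebraic x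
  rw [h] at this
  exact Set.countable_univ_iff.1 this

theorem IsGlobalField.countable {F : Type*} [Field F] (hF : IsGlobalField F) : Countable F := by
  rcases hF with h | ⟨p, _, _, h⟩
  · exact countable_of_isAlgebraic (F := ℚ)
  · have : Countable (RatFunc (ZMod p)) := by
      rw [← Cardinal.mk_le_aleph0_iff,
        IsFractionRing.cardinalMk (Polynomial (ZMod p)) (RatFunc (ZMod p))]
      exact Polynomial.cardinalMk_le_max.trans (max_le Cardinal.mk_le_aleph0 le_rfl)
    exact countable_of_isAlgebraic (F := RatFunc (ZMod p))

/-! ### Conjugacy of places in finite Galois extensions -/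

/-- Weak approximation in separating form. The members of `u`, and those of `w`, are allowed to be
equivalent among themselves, so approximation is applied to the set of places they represent. -/
theorem exists_lt_one_one_lt {M : Type*} [Field M] {ι κ : Type*} [Finite ι] [Finite κ]
    (u : ι → NontrivialAbs M) (w : κ → NontrivialAbs M)
    (h : ∀ i k, ¬ (u i).1.IsEquiv (w k).1) :
    ∃ x : M, (∀ i, (u i).1 x < 1) ∧ ∀ k, 1 < (w k).1 x := by
  classical
  let S : Set (Place M) := Set.range (fun i ↦ Place.mk (u i)) ∪ Set.range (fun k ↦ Place.mk (w k))
  have hS : Finite S := ((Set.finite_range _).union (Set.finite_range _)).to_subtype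
  let V : S → NontrivialAbs M := fun p ↦ p.1.out
  have hV : ∀ p : S, Place.mk (V p) = p.1 := fun p ↦ Quotient.out_eq p.1
  have hV' : ∀ (c : NontrivialAbs M) (hc : Place.mk c ∈ S), (V ⟨_, hc⟩).1.IsEquiv c.1 :=
    fun c _ ↦ Quotient.mk_out (s := nontrivialAbsSetoid M) c
  have hne : Pairwise fun p q : S ↦ ¬ (V p).1.IsEquiv (V q).1 := by
    intro p q hpq he
    apply hpq
    apply Subtype.ext
    rw [← hV p, ← hV q]
    exact Quotient.sound he
  have hd := AbsoluteValue.denseRange_algebraMap_pi (v := fun p ↦ (V p).1)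
    (fun p ↦ (V p).2) hne
  -- The set to be hit: small at the places of `u`, large at the remaining ones.
  choose c hc using fun p : S ↦ (V p).2.exists_abv_gt_one
  let U : (p : S) → Set (WithAbs (V p).1) := fun p ↦
    if p.1 ∈ Set.range (fun i ↦ Place.mk (u i)) then {z | ‖z‖ < 1} else {z | 1 < ‖z‖}
  have hU : IsOpen (Set.univ.pi U) := by
    refine isOpen_set_pi Set.finite_univ fun p _ ↦ ?_
    by_cases hp : p.1 ∈ Set.range (fun i ↦ Place.mk (u i))
    · simpa only [U, if_pos hp] using isOpen_lt continuous_norm continuous_const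
    · simpa only [U, if_neg hp] using isOpen_lt continuous_const continuous_norm
  have hUne : (Set.univ.pi U).Nonempty := by
    rw [Set.univ_pi_nonempty_iff]
    intro p
    by_cases hp : p.1 ∈ Set.range (fun i ↦ Place.mk (u i))
    · refine ⟨0, ?_⟩
      simp only [U, if_pos hp]
      exact norm_zero.trans_lt one_pos
    · refine ⟨WithAbs.toAbs _ (c p), ?_⟩
      simp only [U, if_neg hp]
      exact hc p
  obtain ⟨x, hx⟩ := hd.exists_mem_open hU hUne
  have hx' : ∀ p, algebraMap M (WithAbs (V p).1) x ∈ U p := fun p ↦ hx p trivial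
  refine ⟨x, fun i ↦ ?_, fun k ↦ ?_⟩
  · have hp : Place.mk (u i) ∈ Set.range (fun i ↦ Place.mk (u i)) := ⟨i, rfl⟩
    have := hx' ⟨Place.mk (u i), .inl hp⟩
    simp only [U, if_pos hp] at this
    exact (hV' _ _).lt_one_iff.1 this
  · have hp : Place.mk (w k) ∉ Set.range (fun i ↦ Place.mk (u i)) := by
      rintro ⟨i, hi⟩
      exact h i k (Quotient.exact hi)
    have := hx' ⟨Place.mk (w k), .inr ⟨k, rfl⟩⟩
    simp only [U, if_neg hp] at this
    exact (hV' _ _).one_lt_iff.1 this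

/-- For a finite Galois extension `M/L`, absolute values of `M` whose restrictions to `L` are
equivalent are conjugate up to equivalence. Otherwise, some `x` would have all its conjugates small
for `a` and large for `b`, and its norm would distinguish the two restrictions. -/
theorem exists_isEquiv_comp {L M : Type*} [Field L] [Field M] [Algebra L M]
    [FiniteDimensional L M] [IsGalois L M] (a b : NontrivialAbs M)
    (h : ∀ x y : L, a.1 (algebraMap L M x) ≤ a.1 (algebraMap L M y) ↔
      b.1 (algebraMap L M x) ≤ b.1 (algebraMap L M y)) :
    ∃ σ : Gal(M/L), ∀ x y, a.1 (σ x) ≤ a.1 (σ y) ↔ b.1 x ≤ b.1 y := by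
  by_contra! hne
  have hn : ∀ σ τ : Gal(M/L), ¬ (Place.mapAbs σ a).1.IsEquiv (Place.mapAbs τ b).1 := by
    intro σ τ he
    obtain ⟨x, y, hxy⟩ := hne (σ⁻¹ * τ)
    have key : a.1 ((σ⁻¹ * τ) x) ≤ a.1 ((σ⁻¹ * τ) y) ↔
        b.1 (τ.symm (τ x)) ≤ b.1 (τ.symm (τ y)) := he (τ x) (τ y)
    rw [AlgEquiv.symm_apply_apply, AlgEquiv.symm_apply_apply] at key
    rcases hxy with h1 | h1
    · exact absurd (key.1 h1.1) (not_le.2 h1.2)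
    · exact absurd (key.2 h1.2) (not_le.2 h1.1)
  obtain ⟨x, hxa, hxb⟩ := exists_lt_one_one_lt _ _ hn
  have hN := Algebra.norm_eq_prod_automorphisms L x
  have hx0 : x ≠ 0 := by
    rintro rfl
    simpa using (hxb 1).trans' one_pos
  have hlt : a.1 (algebraMap L M (Algebra.norm L x)) < 1 := by
    rw [hN, map_prod, ← Finset.prod_const_one (ι := Gal(M/L)) (s := Finset.univ)]
    exact Finset.prod_lt_prod_of_nonempty (fun σ _ ↦ a.1.pos (by simpa using hx0))
      (fun σ _ ↦ hxa σ.symm) Finset.univ_nonempty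
  have hgt : 1 < b.1 (algebraMap L M (Algebra.norm L x)) := by
    rw [hN, map_prod, ← Finset.prod_const_one (ι := Gal(M/L)) (s := Finset.univ)]
    exact Finset.prod_lt_prod_of_nonempty (fun _ _ ↦ one_pos)
      (fun σ _ ↦ hxb σ.symm) Finset.univ_nonempty
  have := h 1 (Algebra.norm L x)
  simp only [map_one] at this
  exact absurd (this.2 hgt.le) (not_le.2 hlt)

/-! ### Continuous conjugation along a tower -/

/-- Two real-valued functions induce the same preorder on `S`. If `a` and `b` are absolute values
and `S` is a subfield, this says that their restrictions to `S` are equivalent. The functions are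
unbundled so that the conjugate of `a` by an automorphism `σ` can be written `fun e ↦ a (σ e)`. -/
def OrderAgreeOn {E : Type*} (S : Set E) (a b : E → ℝ) : Prop :=
  ∀ x ∈ S, ∀ y ∈ S, a x ≤ a y ↔ b x ≤ b y

namespace OrderAgreeOn

variable {E : Type*} {S T : Set E} {a b c : E → ℝ}

theorem refl (S : Set E) (a : E → ℝ) : OrderAgreeOn S a a := fun _ _ _ _ ↦ Iff.rfl

theorem symm (h : OrderAgreeOn S a b) : OrderAgreeOn S b a :=
  fun x hx y hy ↦ (h x hx y hy).symm

theorem trans (h : OrderAgreeOn S a b) (h' : OrderAgreeOn S b c) : OrderAgreeOn S a c :=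
  fun x hx y hy ↦ (h x hx y hy).trans (h' x hx y hy)

theorem mono (hST : S ⊆ T) (h : OrderAgreeOn T a b) : OrderAgreeOn S a b :=
  fun x hx y hy ↦ h x (hST hx) y (hST hy)

end OrderAgreeOn

/-- The conjugacy of absolute values of `M` over `L`, with the conjugating automorphism extended to
the possibly infinite extension `E`. -/
theorem exists_mem_fixingSubgroup_orderAgreeOn {K E : Type*} [Field K] [Field E] [Algebra K E]
    [IsGalois K E] {L M : IntermediateField K E} (hLM : L ≤ M) [FiniteDimensional K M]
    [IsGalois K M] (a b : NontrivialAbs E)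
    (ha : ∃ x : K, x ≠ 0 ∧ a.1 (algebraMap K E x) ≠ 1)
    (hb : ∃ x : K, x ≠ 0 ∧ b.1 (algebraMap K E x) ≠ 1)
    (h : OrderAgreeOn (L : Set E) a.1 b.1) :
    ∃ τ ∈ L.fixingSubgroup, OrderAgreeOn (M : Set E) (fun e ↦ a.1 (τ e)) b.1 := by
  let M' : IntermediateField L E := IntermediateField.extendScalars hLM
  have : IsScalarTower K L M' := IsScalarTower.of_algebraMap_eq fun _ ↦ rfl
  have : FiniteDimensional K M' := ‹FiniteDimensional K M›
  have : IsGalois K M' := ‹IsGalois K M›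
  have : FiniteDimensional L M' := FiniteDimensional.right K L M'
  have : IsGalois L M' := IsGalois.tower_top_of_isGalois K L M'
  have key : ∀ c : NontrivialAbs E, (∃ x : K, x ≠ 0 ∧ c.1 (algebraMap K E x) ≠ 1) →
      (c.1.comp (algebraMap M' E).injective).IsNontrivial := fun c ⟨x, hx, hc⟩ ↦
    ⟨algebraMap K M' x, by simpa using hx, hc⟩
  obtain ⟨σ, hσ⟩ := exists_isEquiv_comp (L := L) (M := M') ⟨_, key a ha⟩ ⟨_, key b hb⟩
    fun x y ↦ h x x.2 y y.2
  let τ : Gal(E/L) := σ.liftNormal E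
  have hτ : ∀ x : M', τ x = σ x := fun x ↦ σ.liftNormal_commutes E x
  refine ⟨τ.restrictScalars K, fun x ↦ τ.commutes x, fun x hx y hy ↦ ?_⟩
  have := hσ ⟨x, hx⟩ ⟨y, hy⟩
  change a.1 (τ x) ≤ a.1 (τ y) ↔ _
  rw [hτ ⟨x, hx⟩, hτ ⟨y, hy⟩]
  exact this

/-- A continuous choice, for `y : Y`, of an automorphism `r y` carrying the absolute value `A y₀` to
one equivalent to `A y`. It is the limit of maps `t n`, where `t n y` has the required property on
`L n` and depends only on the restriction of `A y` to `L n` up to equivalence. The first of these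
facts makes the limit correct, the second makes it locally constant on each `L n`. -/
theorem exists_continuous_transporter {K E : Type*} [Field K] [Field E] [Algebra K E]
    [IsGalois K E] (L : ℕ → IntermediateField K E) (hL : Monotone L) (hL0 : L 0 = ⊥)
    (hLE : ∀ e, ∃ n, e ∈ L n) [∀ n, FiniteDimensional K (L n)] [∀ n, IsGalois K (L n)]
    {Y : Type*} [TopologicalSpace Y] (A : Y → NontrivialAbs E)
    (hA : ∀ y, ∃ x : K, x ≠ 0 ∧ (A y).1 (algebraMap K E x) ≠ 1)
    (hK : ∀ y z, OrderAgreeOn ((⊥ : IntermediateField K E) : Set E) (A y).1 (A z).1)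
    (hloc : ∀ n y, ∀ᶠ z in nhds y, OrderAgreeOn (L n : Set E) (A y).1 (A z).1) (y₀ : Y) :
    ∃ r : Y → Gal(E/K), Continuous r ∧
      ∀ y, OrderAgreeOn Set.univ (fun e ↦ (A y₀).1 (r y e)) (A y).1 := by
  let P : ℕ → (Y → Gal(E/K)) → Prop := fun n t ↦
    (∀ y, OrderAgreeOn (L n : Set E) (fun e ↦ (A y₀).1 (t y e)) (A y).1) ∧
      ∀ y z, OrderAgreeOn (L n : Set E) (A y).1 (A z).1 → t y = t z
  have h0 : P 0 (fun _ ↦ 1) := ⟨fun y ↦ by rw [hL0]; exact hK y₀ y, fun _ _ _ ↦ rfl⟩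
  have hstep : ∀ n t, P n t → ∃ t', P (n + 1) t' ∧ ∀ y, ∀ e ∈ L n, t' y e = t y e := by
    intro n t ht
    have hle : L n ≤ L (n + 1) := hL n.le_succ
    have hex : ∀ y, ∃ g : Gal(E/K), (∀ e ∈ L n, g e = t y e) ∧
        OrderAgreeOn (L (n + 1) : Set E) (fun e ↦ (A y₀).1 (g e)) (A y).1 := by
      intro y
      obtain ⟨x, hx, hx1⟩ := hA y₀
      have hx1' : (A y₀).1 (t y (algebraMap K E x)) ≠ 1 := by rwa [AlgEquiv.commutes]
      obtain ⟨τ, hτ, h⟩ := exists_mem_fixingSubgroup_orderAgreeOn hle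
        (Place.mapAbs (t y).symm (A y₀)) (A y) ⟨x, hx, hx1'⟩ (hA y) (ht.1 y)
      refine ⟨t y * τ, fun e he ↦ ?_, h⟩
      rw [AlgEquiv.mul_apply, (IntermediateField.mem_fixingSubgroup_iff _ _).1 hτ e he]
    choose g hg hgA using hex
    -- Choosing `g` at one representative of each class makes the next map depend on the class only.
    let R : Setoid Y :=
      { r := fun y z ↦ OrderAgreeOn (L (n + 1) : Set E) (A y).1 (A z).1
        iseqv := ⟨fun _ ↦ .refl _ _, .symm, .trans⟩ }
    let p : Y → Y := fun y ↦ (Quotient.mk R y).out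
    have hp : ∀ y, OrderAgreeOn (L (n + 1) : Set E) (A (p y)).1 (A y).1 :=
      fun y ↦ Quotient.exact (Quotient.out_eq (Quotient.mk R y))
    refine ⟨fun y ↦ g (p y), ⟨fun y ↦ (hgA (p y)).trans (hp y), fun y z hyz ↦ ?_⟩,
      fun y e he ↦ ?_⟩
    · have : Quotient.mk R y = Quotient.mk R z := Quotient.sound hyz
      simp only [p, this]
    · rw [hg _ e he, ht.2 (p y) y ((hp y).mono hle)]
  choose! f hfP hf using hstep
  let t : ℕ → Y → Gal(E/K) := fun n ↦ Nat.rec (fun _ ↦ 1) f n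
  have htP : ∀ n, P n (t n) := fun n ↦ by
    induction n with
    | zero => exact h0
    | succ n ih => exact hfP n _ ih
  have ht : ∀ n y, ∀ e ∈ L n, t (n + 1) y e = t n y e := fun n ↦ hf n _ (htP n)
  have hlim : ∀ y, ∃ g : Gal(E/K), ∀ n, ∀ e ∈ L n, g e = t n y e := by
    intro y
    -- The sets of automorphisms agreeing with `t n y` on `L n` are nested, closed and nonempty.
    let C : ℕ → Set Gal(E/K) := fun n ↦ {g | ∀ e ∈ L n, g e = t n y e}
    have hC : ∀ n, IsClosed (C n) := fun n ↦ by
      have : C n = (fun g ↦ (t n y)⁻¹ * g) ⁻¹' ((L n).fixingSubgroup : Set Gal(E/K)) := by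
        ext g
        simp only [C, Set.mem_ofPred_eq, Set.mem_preimage, SetLike.mem_coe,
          IntermediateField.mem_fixingSubgroup_iff, AlgEquiv.mul_apply]
        refine forall₂_congr fun e _ ↦ ?_
        exact (AlgEquiv.symm_apply_eq (t n y)).symm
      rw [this]
      exact (L n).fixingSubgroup_isClosed.preimage (continuous_const_mul _)
    have hCs : ∀ n, C (n + 1) ⊆ C n := fun n g hg e he ↦
      (hg e (hL n.le_succ he)).trans (ht n y e he)
    obtain ⟨g, hg⟩ := IsCompact.nonempty_iInter_of_sequence_nonempty_isCompact_isClosed C hCs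
      (fun n ↦ ⟨t n y, fun _ _ ↦ rfl⟩) (hC 0).isCompact hC
    exact ⟨g, fun n ↦ Set.mem_iInter.1 hg n⟩
  choose r hr using hlim
  refine ⟨r, ?_, fun y x _ z _ ↦ ?_⟩
  · rw [continuous_iff_continuousAt]
    intro y
    have : Filter.Tendsto (fun z ↦ (r y)⁻¹ * r z) (nhds y) (nhds 1) := by
      intro U hU
      obtain ⟨M, hM, hMU⟩ := (krullTopology_mem_nhds_one_iff K E U).1 hU
      obtain ⟨n, hn⟩ : ∃ n, M ≤ L n := by
        obtain ⟨S, rfl⟩ := IntermediateField.essFiniteType_iff.1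
          (inferInstance : Algebra.EssFiniteType K M)
        choose m hm using hLE
        refine ⟨S.sup m, IntermediateField.adjoin_le_iff.2 fun e he ↦ ?_⟩
        exact hL (Finset.le_sup (f := m) he) (hm e)
      rw [Filter.mem_map]
      filter_upwards [hloc n y] with z hz
      refine hMU ((IntermediateField.mem_fixingSubgroup_iff _ _).2 fun e he ↦ ?_)
      rw [AlgEquiv.mul_apply]
      refine (AlgEquiv.symm_apply_eq (r y)).2 ?_
      rw [hr z n e (hn he), hr y n e (hn he), (htP n).2 y z hz]
    simpa [ContinuousAt] using this.const_mul (r y)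
  · obtain ⟨n, hn⟩ := hLE x
    obtain ⟨m, hm⟩ := hLE z
    have hx := hL (le_max_left n m) hn
    have hz := hL (le_max_right n m) hm
    simpa only [hr y _ x hx, hr y _ z hz] using (htP (max n m)).1 y x hx z hz

/-! ### Places of a Galois extension of a global field -/

namespace Place

variable {K E : Type*} [Field K] [Field E] [Algebra K E]

/-- Divisibility of places, tested on arbitrary representatives. -/
theorem Divides.restrict_isEquiv {v : Place K} {a : NontrivialAbs E} {b : NontrivialAbs K}
    (h : (mk a).Divides v) (hb : mk b = v) :
    (a.1.comp (algebraMap K E).injective).IsEquiv b.1 := by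
  obtain ⟨a', b', ha, rfl, hab⟩ := h
  have ha : a'.1.IsEquiv a.1 := Quotient.exact ha
  have hb : b.1.IsEquiv b'.1 := Quotient.exact hb
  intro x y
  rw [hb x y, ← hab.comp_eq]
  exact (ha (algebraMap K E x) (algebraMap K E y)).symm

theorem divides_mk_comp (a : NontrivialAbs E)
    (ha : (a.1.comp (algebraMap K E).injective).IsNontrivial) :
    (mk a).Divides (mk ⟨_, ha⟩) :=
  ⟨a, _, rfl, rfl, ⟨rfl⟩⟩

end Place

/-- An exhaustion of a countable Galois extension by finite Galois subextensions, starting at `K`. -/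
theorem exists_galois_tower {F E : Type*} [Field F] [Field E] [Algebra F E] [IsGalois F E]
    [Countable E] (K : IntermediateField F E) [FiniteDimensional F K] [IsGalois F K] :
    ∃ N : ℕ → FiniteGaloisIntermediateField F E, Monotone N ∧
      (N 0).toIntermediateField = K ∧ ∀ e, ∃ n, e ∈ (N n).toIntermediateField := by
  obtain ⟨f, hf⟩ := exists_surjective_nat E
  let N : ℕ → FiniteGaloisIntermediateField F E := fun n ↦
    Nat.rec (.mk K) (fun n M ↦ M ⊔ FiniteGaloisIntermediateField.adjoin F {f n}) n
  refine ⟨N, monotone_nat_of_le_succ fun n ↦ le_sup_left, rfl, fun e ↦ ?_⟩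
  obtain ⟨n, rfl⟩ := hf e
  have : FiniteGaloisIntermediateField.adjoin F {f n} ≤ N (n + 1) := le_sup_right
  exact ⟨n + 1, this (FiniteGaloisIntermediateField.subset_adjoin F {f n} rfl)⟩

/-- The restriction of a place to a finite Galois subfield is locally constant. -/
theorem eventually_orderAgreeOn {F E : Type*} [Field F] [Field E] [Algebra F E]
    {K : IntermediateField F E} {v : Place K} (L : FiniteGaloisIntermediateField F E)
    (A : placesOver K v → NontrivialAbs E) (hA : ∀ y, Place.mk (A y) = y) (y : placesOver K v)
    (hy : ((A y).1.comp (algebraMap L.toIntermediateField E).injective).IsNontrivial) :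
    ∀ᶠ z in nhds y, OrderAgreeOn (L.toIntermediateField : Set E) (A y).1 (A z).1 := by
  let w : Place L.toIntermediateField := Place.mk ⟨_, hy⟩
  have hopen : IsOpen {z : placesOver K v | (z : Place E).Divides w} :=
    ⟨_, TopologicalSpace.isOpen_generateFrom_of_mem ⟨L.toIntermediateField, inferInstance,
      inferInstance, w, rfl⟩, rfl⟩
  have hyw : (y : Place E).Divides w := hA y ▸ Place.divides_mk_comp (A y) hy
  filter_upwards [hopen.mem_nhds hyw] with z hz e he f hf
  have hz : (Place.mk (A z)).Divides w := (hA z).symm ▸ hz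
  exact (hz.restrict_isEquiv rfl ⟨e, he⟩ ⟨f, hf⟩).symm

theorem theorem4 {F : Type u} {E : Type v} [Field F] [Field E] [Algebra F E]
    (hF : IsGlobalField F) [IsGalois F E]
    (K : IntermediateField F E) [FiniteDimensional F K] [IsGalois F K] (v : Place K) :
    (transitionDiagrams K v).Nonempty := by
  -- Without places of `E` over `v` the empty map is a diagram.
  rcases isEmpty_or_nonempty (placesOver K v) with hY | ⟨⟨y₀⟩⟩
  · exact ⟨fun p ↦ isEmptyElim p.1, fun x ↦ isEmptyElim x, fun x ↦ isEmptyElim x,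
      fun x ↦ isEmptyElim x, continuous_of_const fun x ↦ isEmptyElim x.1⟩
  have := hF.countable
  have : Countable E := countable_of_isAlgebraic (F := F)
  obtain ⟨N, hN, hN0, hNE⟩ := exists_galois_tower K
  have hKN : ∀ n, K ≤ (N n).toIntermediateField := fun n ↦ hN0.symm.le.trans (hN n.zero_le)
  let L : ℕ → IntermediateField K E := fun n ↦ IntermediateField.extendScalars (hKN n)
  have hL0 : L 0 = ⊥ := by
    refine SetLike.ext fun x ↦ ?_
    rw [IntermediateField.mem_extendScalars, hN0, IntermediateField.mem_bot]
    exact ⟨fun hx ↦ ⟨⟨x, hx⟩, rfl⟩, fun ⟨z, hz⟩ ↦ hz ▸ z.2⟩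
  have : ∀ n, IsScalarTower F K (L n) := fun n ↦ IsScalarTower.of_algebraMap_eq fun _ ↦ rfl
  have : ∀ n, FiniteDimensional F (L n) := fun n ↦ (N n).finiteDimensional
  have : ∀ n, IsGalois F (L n) := fun n ↦ (N n).isGalois
  have : ∀ n, FiniteDimensional K (L n) := fun n ↦ FiniteDimensional.right F K (L n)
  have : ∀ n, IsGalois K (L n) := fun n ↦ IsGalois.tower_top_of_isGalois F K (L n)
  let A : placesOver K v → NontrivialAbs E := fun y ↦ y.1.out
  have hA : ∀ y, Place.mk (A y) = y := fun y ↦ Quotient.out_eq y.1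
  let b : NontrivialAbs K := v.out
  have hb : ∀ y, ((A y).1.comp (algebraMap K E).injective).IsEquiv b.1 := fun y ↦
    Place.Divides.restrict_isEquiv ((hA y).symm ▸ y.2) (Quotient.out_eq v)
  have hAK : ∀ y, ∃ x : K, x ≠ 0 ∧ (A y).1 (algebraMap K E x) ≠ 1 :=
    fun y ↦ (hb y).isNontrivial_congr.2 b.2
  obtain ⟨r, hr, hrA⟩ := exists_continuous_transporter L (fun m n hmn ↦ hN hmn) hL0 hNE A hAK
    (by
      rintro y z _ ⟨x, rfl⟩ _ ⟨x', rfl⟩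
      exact ((hb y).trans (hb z).symm) x x')
    (fun n y ↦ eventually_orderAgreeOn (N n) A hA y
      (let ⟨x, hx, hx1⟩ := hAK y; ⟨⟨x, hKN n x.2⟩, fun h ↦ hx (Subtype.ext
        (congrArg (fun z : (N n).toIntermediateField ↦ (z : E)) h)), hx1⟩)) y₀
  have hrA' : ∀ y e f, (A y₀).1 (r y e) ≤ (A y₀).1 (r y f) ↔ (A y).1 e ≤ (A y).1 f :=
    fun y e f ↦ hrA y e trivial f trivial
  -- As `r y` pulls `A y₀` back to `A y`, the place `y` is `(r y)⁻¹ • y₀`.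
  refine ⟨fun p ↦ (r p.2)⁻¹ * r p.1, fun x ↦ inv_mul_cancel _, fun x y ↦ ?_, fun x y z ↦ by group,
    by fun_prop⟩
  rw [← hA x, ← hA y]
  refine Quotient.sound fun e f ↦ ?_
  change (A x).1 ((r x)⁻¹ (r y e)) ≤ (A x).1 ((r x)⁻¹ (r y f)) ↔ _
  rw [← hrA' x, ← hrA' y]
  change (A y₀).1 (r x ((r x).symm _)) ≤ (A y₀).1 (r x ((r x).symm _)) ↔ _
  rw [AlgEquiv.apply_symm_apply, AlgEquiv.apply_symm_apply]
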